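/- A Gaussian tree is a tree $T=(V,E)$ on a finite vertex set $V$ with $N=|V|$ nodes and edge weights $w_e\in[-1,1]$; its normalized covariance matrix $\Sigma=(\sigma_{ij})$ has $\sigma_{ii}=1$ and, for $i\ne j$, $\sigma_{ij}$ equal to the product of the edge weights along the unique path from $i$ to $j$. For covariance matrices $S_1,S_2$ of centered Gaussian distributions put $$D(S_1\|S_2)=\tfrac12\ln\frac{|S_2|}{|S_1|}+\tfrac12\operatorname{tr}(S_2^{-1}S_1)-\tfrac N2 ,$$ and, given $\Sigma_1,\Sigma_2$, define $\Sigma_\lambda$ by $\Sigma_\lambda^{-1}=\lambda\Sigma_1^{-1}+(1-\lambda)\Sigma_2^{-1}$. The optimal Chernoff parameter $\lambda^*$ of $(\Sigma_1,\Sigma_2)$ is the point $\lambda\in[0,1]$ with $D(\Sigma_\lambda\|\Sigma_2)=D(\Sigma_\lambda\|\Sigma_1)$. A grafting operation $(i,p,q)$ with $p\neq q$ transforms a Gaussian tree into another one by replacing an edge $\{i,p\}$ by the edge $\{i,q\}$ with the same weight, everything else being unchanged. A star grouping of a tree is a partition of its nodes into a center and finitely many super leaves, each inducing a subtree, such that no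 edge joins two different super leaves. Two Gaussian trees $T_1,T_2$ are connected by independent grafting operations if $T_2$ is obtained from $T_1$ by a finite chain of grafting operations and there is a star grouping of $T_1$ such that each operation $(i,p,q)$ is of one of the following types, and different operations involve disjoint sets of super leaves: 1. $i,p,q$ lie in one super leaf $L$ (a subtree of $L$ is moved within $L$; the operation involves $L$); 2. $i$ lies in the center and $p,q$ lie in one super leaf $L$ (the part of the tree outside $L$ is moved to another location in $L$; the operation involves $L$); 3. $i,p$ lie in a super leaf $L$ and $q$ lies in another super leaf $L'$ (a subtree of $L$ is moved to $L'$; the operation involves $L$ and $L'$). **Proposition.** Let $T_1,T_2$ be Gaussian trees connected by independent grafting operations, with all edge weights of $T_1$ satisfying $|w_e|<1$, and let $\Sigma_1,\Sigma_2$ be their normalized covariance matrices. Then $\lambda^*=1/2$: the equation $D(\Sigma_\lambda\|\Sigma_2)=D(\Sigma_\lambda\|\Sigma_1)$ holds at $\lambda=1/2$, and if $\Sigma_1\neq\Sigma_2$, then $\lambda=1/2$ is its only solution in $[0,1]$. -/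

import Mathlib

/-- An edge-weighted tree on the vertex set `V`, with edge weights in `[-1, 1]`.
The value of `w` at a pair that is not an edge plays no role. -/
structure GaussianTree (V : Type*) where
  graph : SimpleGraph V
  isTree : graph.IsTree
  w : Sym2 V → ℝ
  w_mem : ∀ e ∈ graph.edgeSet, w e ∈ Set.Icc (-1 : ℝ) 1

/-- The covariance matrix of the normalized Gaussian distribution on a weighted tree: the `(i, j)`
entry is the product of the weights along the unique path from `i` to `j` (so it is `1` for
`i = j`, and `w s(i, j)` when `i` and `j` are adjacent). -/
noncomputable def GaussianTree.cov {V : Type*} (T : GaussianTree V) : Matrix V V ℝ :=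
  Matrix.of fun i j =>
    ((T.isTree.existsUnique_path i j).choose.edges.map T.w).prod

/-- The Kullback-Leibler divergence `D(S₁ || S₂)` between the centered Gaussian distributions with
covariance matrices `S₁` and `S₂`. -/
noncomputable def gaussianKL {V : Type*} [Fintype V] [DecidableEq V] (S₁ S₂ : Matrix V V ℝ) : ℝ :=
  1 / 2 * Real.log (S₂.det / S₁.det) + 1 / 2 * (S₂⁻¹ * S₁).trace - (Fintype.card V : ℝ) / 2

/-- The covariance matrix `S_t` in the exponential family of `S₁` and `S₂`:
`S_t⁻¹ = t S₁⁻¹ + (1 - t) S₂⁻¹`. -/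
noncomputable def expFamilyCov {V : Type*} [Fintype V] [DecidableEq V]
    (S₁ S₂ : Matrix V V ℝ) (t : ℝ) : Matrix V V ℝ :=
  (t • S₁⁻¹ + (1 - t) • S₂⁻¹)⁻¹

/-- `t` is a point of `[0, 1]` with `D(S_t || S₂) = D(S_t || S₁)`, the equation that
defines the optimal Chernoff parameter. -/
def IsChernoffParameter {V : Type*} [Fintype V] [DecidableEq V]
    (S₁ S₂ : Matrix V V ℝ) (t : ℝ) : Prop :=
  t ∈ Set.Icc (0 : ℝ) 1 ∧
    gaussianKL (expFamilyCov S₁ S₂ t) S₂ = gaussianKL (expFamilyCov S₁ S₂ t) S₁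

/-- The data of a grafting operation: the edge `{i, p}` is cut and the edge `{i, q}` is pasted. -/
structure GraftingOp (V : Type*) where
  i : V
  p : V
  q : V

/-- `T'` is obtained from `T` by the grafting operation `o`: the edge `{i, p}` is replaced by the
edge `{i, q}`, which gets the same weight, and nothing else changes. (Since `T'` is a tree again,
`q` lies in the component of `p` after the cut.) -/
def GraftingOp.Carries {V : Type*} (o : GraftingOp V) (T T' : GaussianTree V) : Prop :=
  o.p ≠ o.q ∧
  s(o.i, o.p) ∈ T.graph.edgeSet ∧
  T'.graph.edgeSet = (T.graph.edgeSet \ {s(o.i, o.p)}) ∪ {s(o.i, o.q)} ∧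
  T'.w s(o.i, o.q) = T.w s(o.i, o.p) ∧
  ∀ e ∈ T'.graph.edgeSet, e ≠ s(o.i, o.q) → T'.w e = T.w e

/-- A star-shaped regrouping of the nodes of a tree `G`: `cell v = none` puts `v` in the center,
`cell v = some l` puts `v` in the super leaf `l`. The center and each super leaf are subtrees, and
no edge joins two different super leaves. (As `G` is a tree, each super leaf is then joined to the
center by exactly one edge.) -/
def IsStarGrouping {V : Type*} (G : SimpleGraph V) {m : ℕ} (cell : V → Option (Fin m)) : Prop :=
  (G.induce {v | cell v = none}).Connected ∧
  (∀ l : Fin m, (G.induce {v | cell v = some l}).Connected) ∧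
  ∀ (u v : V) (l l' : Fin m), G.Adj u v → cell u = some l → cell v = some l' → l = l'

/-- `o.Involves cell L`: the grafting operation `o` is of one of the three types allowed around the
center of the star, and `L` is the set of the (one or two) super leaves that it involves. -/
inductive GraftingOp.Involves {V : Type*} (o : GraftingOp V) {m : ℕ} (cell : V → Option (Fin m)) :
    Set (Fin m) → Prop
  /-- A subtree of a super leaf is cut and pasted to another part of this super leaf. -/
  | within (l : Fin m) (hi : cell o.i = some l) (hp : cell o.p = some l)
      (hq : cell o.q = some l) : o.Involves cell {l}
  /-- The part of the tree outside a super leaf is cut from the super leaf and pasted to another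
  location in this super leaf. -/
  | outside (l : Fin m) (hi : cell o.i = none) (hp : cell o.p = some l)
      (hq : cell o.q = some l) : o.Involves cell {l}
  /-- A subtree of a super leaf is cut and pasted to a different super leaf. -/
  | across (l l' : Fin m) (hne : l ≠ l') (hi : cell o.i = some l) (hp : cell o.p = some l)
      (hq : cell o.q = some l') : o.Involves cell {l, l'}

/-- Grafting operations on a tree `T` are independent if, for some star-shaped regrouping of the
nodes of `T`, they involve pairwise disjoint sets of super leaves. -/
def IndependentGraftings {V : Type*} (T : GaussianTree V) {n : ℕ} (o : Fin n → GraftingOp V) :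
    Prop :=
  ∃ (m : ℕ) (cell : V → Option (Fin m)) (L : Fin n → Set (Fin m)),
    IsStarGrouping T.graph cell ∧
    (∀ k, (o k).Involves cell (L k)) ∧
    ∀ k k', k ≠ k' → Disjoint (L k) (L k')

/-- `T₁` and `T₂` are connected by a chain of independent grafting operations. -/
def ConnectedByIndependentGraftings {V : Type*} (T₁ T₂ : GaussianTree V) : Prop :=
  ∃ (n : ℕ) (T : Fin (n + 1) → GaussianTree V) (o : Fin n → GraftingOp V),
    T 0 = T₁ ∧ T (Fin.last n) = T₂ ∧
    (∀ k : Fin n, (o k).Carries (T k.castSucc) (T k.succ)) ∧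
    IndependentGraftings T₁ o

/-! For weights of absolute value below 1, the inverse covariance of a tree is `K = 1 + ∑ edgeForm`
over its edges. A graft therefore changes `K` by `Δ = edgeForm w i p - edgeForm w i q`, a multiple
of `d uᵀ + u dᵀ` with `d = e_p - e_q` and `u = w² (e_p + e_q) - 2 w e_i`.

Determinants: there is a vector `x` on the `p`-side of the cut with `d ⬝ᵥ x = 2` for which `K - Δ`
is the congruent of `K` by the reflection `1 - x dᵀ`. Hence every graft preserves the determinant
(`det_prec_sub_edgeForm`), the logarithms in the two divergences agree, and the Chernoff equation
becomes `tr ((K₁ - K₂) (t K₁ + (1 - t) K₂)⁻¹) = 0`.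

At `t = 1/2` put `M = K₁ + K₂ = 2 K₁ - ∑ Δ_j`. It suffices that `dᵀ M⁻¹ u = 0` for each graft
separately. If the other grafts kill vectors supported on the `i`-side, the truncated covariance
column at `i` is orthogonal to `d`, and `u` is a multiple of its image under `M`. If they kill
vectors supported on the `p`-side, the reflection vector `x` is orthogonal to `u` and `M` maps it to
a nonzero multiple of `d` (`trace_grafting_eq_zero`). Independence supplies one of the two cases:
one side of the cut lies inside the super leaf of `p`, which no other graft touches
(`edgeSide_subset`).

Uniqueness: by the resolvent identity, two solutions `s ≠ t` would give `tr (D P⁻¹ D Q⁻¹) = 0` with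
`D = K₁ - K₂ ≠ 0` and `P`, `Q` positive definite, whereas this trace is positive. -/

open Matrix Finset

/-- The contribution of an edge `{i, j}` of weight `w` to the precision matrix of a tree. -/
noncomputable def edgeForm {V : Type*} [DecidableEq V] (w : ℝ) (i j : V) : Matrix V V ℝ :=
  (1 / (1 - w ^ 2)) •
    (w ^ 2 • (single i i 1 + single j j 1) - w • (single i j 1 + single j i 1))

theorem edgeForm_comm {V : Type*} [DecidableEq V] (w : ℝ) (i j : V) :
    edgeForm w i j = edgeForm w j i := by
  unfold edgeForm
  rw [add_comm (single i i _), add_comm (single i j _)]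

theorem edgeForm_transpose {V : Type*} [DecidableEq V] (w : ℝ) (i j : V) :
    (edgeForm w i j)ᵀ = edgeForm w i j := by
  simp [edgeForm, add_comm (single j i w)]

theorem edgeForm_mulVec {V : Type*} [Fintype V] [DecidableEq V] (w : ℝ) (i j : V) (x : V → ℝ) :
    edgeForm w i j *ᵥ x =
      (1 / (1 - w ^ 2)) • ((w ^ 2 * x i - w * x j) • Pi.single i (1 : ℝ) +
        (w ^ 2 * x j - w * x i) • Pi.single j (1 : ℝ)) := by
  have hs : ∀ a b : V, single a b (1 : ℝ) *ᵥ x = x b • Pi.single a (1 : ℝ) := by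
    intro a b
    ext v
    rw [single_mulVec]
    simp [Function.update_apply, Pi.single_apply]
  simp only [edgeForm, smul_mulVec, sub_mulVec, add_mulVec, hs]
  module

/-- The matrix `edgeForm` of an edge given as an unordered pair. -/
noncomputable def edgeMatrix {V : Type*} [DecidableEq V] (w : Sym2 V → ℝ) :
    Sym2 V → Matrix V V ℝ :=
  Sym2.lift ⟨fun i j => edgeForm (w s(i, j)) i j, fun i j => by
    beta_reduce
    rw [edgeForm_comm, Sym2.eq_swap]⟩

@[simp] theorem edgeMatrix_mk {V : Type*} [DecidableEq V] (w : Sym2 V → ℝ) (i j : V) :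
    edgeMatrix w s(i, j) = edgeForm (w s(i, j)) i j := rfl

/-! ### Precision matrix of a tree: inverse of the covariance, positivity -/

namespace GaussianTree

/-- The edges of a weighted tree as a finite set. -/
noncomputable def edges {V : Type*} [Fintype V] (T : GaussianTree V) : Finset (Sym2 V) :=
  (Set.toFinite T.graph.edgeSet).toFinset

@[simp] theorem mem_edges {V : Type*} [Fintype V] {T : GaussianTree V} {e : Sym2 V} :
    e ∈ T.edges ↔ e ∈ T.graph.edgeSet := by
  simp [edges]

/-- The precision matrix of a weighted tree. -/
noncomputable def prec {V : Type*} [Fintype V] [DecidableEq V] (T : GaussianTree V) :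
    Matrix V V ℝ :=
  1 + ∑ e ∈ T.edges, edgeMatrix T.w e

theorem prec_transpose {V : Type*} [Fintype V] [DecidableEq V] (T : GaussianTree V) :
    T.precᵀ = T.prec := by
  have h : ∀ e, (edgeMatrix T.w e)ᵀ = edgeMatrix T.w e := by
    intro e
    induction e with
    | _ i j => simp [edgeForm_transpose]
  simp [prec, transpose_sum, h]

theorem cov_eq_of_isPath {V : Type*} (T : GaussianTree V) {u v : V} (P : T.graph.Walk u v)
    (hP : P.IsPath) : T.cov u v = (P.edges.map T.w).prod := by
  have h := T.isTree.existsUnique_path u v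
  have : h.choose = P := h.unique h.choose_spec.1 hP
  simp [cov, this]

theorem cov_self {V : Type*} (T : GaussianTree V) (v : V) : T.cov v v = 1 := by
  simp [T.cov_eq_of_isPath (SimpleGraph.Walk.nil : T.graph.Walk v v) (by simp)]

theorem cov_symm {V : Type*} (T : GaussianTree V) (u v : V) : T.cov u v = T.cov v u := by
  obtain ⟨P, hP, -⟩ := T.isTree.existsUnique_path u v
  rw [T.cov_eq_of_isPath P hP, T.cov_eq_of_isPath P.reverse hP.reverse]
  simp [List.map_reverse, List.prod_reverse]

/-- Rooting a tree at `r`: every other node has a parent, and the edges are the pairs of a node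
and its parent. -/
theorem exists_parent {V : Type*} [Fintype V] [DecidableEq V] (T : GaussianTree V) (r : V) :
    ∃ par : V → V, (∀ v ≠ r, T.graph.Adj v (par v)) ∧
      (∀ v ≠ r, T.cov v r = T.w s(v, par v) * T.cov (par v) r) ∧
      Set.InjOn (fun v => s(v, par v)) (univ.erase r : Finset V) ∧
      (univ.erase r).image (fun v => s(v, par v)) = T.edges := by
  classical
  choose P hP hP' using fun v => T.isTree.existsUnique_path v r
  have hcons : ∀ v ≠ r, ∃ h : T.graph.Adj v (P v).snd, P v = .cons h (P (P v).snd) := by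
    intro v hv
    have hn : ¬ (P v).Nil := SimpleGraph.Walk.not_nil_of_ne hv
    refine ⟨(P v).adj_snd hn, ?_⟩
    conv_lhs => rw [← (P v).cons_tail_eq hn]
    rw [hP' _ (P v).tail (hP v).tail]
  have hlen : ∀ v ≠ r, (P v).length = (P (P v).snd).length + 1 := by
    intro v hv
    obtain ⟨h, e⟩ := hcons v hv
    conv_lhs => rw [e]
    simp
  refine ⟨fun v => (P v).snd, fun v hv => (hcons v hv).1, ?_, ?_, ?_⟩
  · intro v hv
    obtain ⟨h, e⟩ := hcons v hv
    have e' := congrArg (fun W => (W.edges.map T.w).prod) e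
    rw [T.cov_eq_of_isPath _ (hP v), T.cov_eq_of_isPath _ (hP (P v).snd), e']
    simp
  · intro a ha b hb hab
    have ha' : a ≠ r := by simpa using ha
    have hb' : b ≠ r := by simpa using hb
    rcases Sym2.eq_iff.1 hab with h | ⟨h1, h2⟩
    · exact h.1
    · beta_reduce at h1 h2
      -- If `a` and `b` were each other's parents, each would be one step farther from the root than
      -- the other.
      have h3 := hlen a ha'
      have h4 := hlen b hb'
      rw [h2] at h3
      rw [← h1] at h4
      omega
  · ext e
    simp only [mem_image, mem_erase, mem_univ, and_true, mem_edges]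
    constructor
    · rintro ⟨v, hv, rfl⟩
      exact (hcons v hv).1
    -- A neighbor of `b` lying on the path from `b` to the root must be the next node of that path.
    · have key : ∀ a b, T.graph.Adj a b → a ∈ (P b).support → ∃ v ≠ r, s(v, (P v).snd) = s(a, b) := by
        intro a b hab ha
        have h := T.isTree.isAcyclic.eq_snd_of_adj_start (hP b) hab.symm ha
        refine ⟨b, ?_, by rw [← h, Sym2.eq_swap]⟩
        rintro rfl
        have h0 : P b = .nil := (hP' b .nil (by simp)).symm
        rw [h0] at ha
        simp at ha
        exact hab.ne ha
      induction e with
      | _ a b =>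
        intro hab
        have hab : T.graph.Adj a b := hab
        by_cases ha : a ∈ (P b).support
        · exact key a b hab ha
        · have h0 : P a = .cons hab (P b) :=
            (hP' a _ ((SimpleGraph.Walk.cons_isPath_iff _ _).2 ⟨hP b, ha⟩)).symm
          obtain ⟨v, hv, h⟩ := key b a hab.symm (by rw [h0]; simp)
          exact ⟨v, hv, by rw [h, Sym2.eq_swap]⟩

theorem prec_eq_rooted {V : Type*} [Fintype V] [DecidableEq V] (T : GaussianTree V) (r : V) :
    ∃ par : V → V, (∀ v ≠ r, T.graph.Adj v (par v)) ∧
      (∀ v ≠ r, T.cov v r = T.w s(v, par v) * T.cov (par v) r) ∧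
      T.prec = 1 + ∑ v ∈ univ.erase r, edgeForm (T.w s(v, par v)) v (par v) := by
  obtain ⟨par, h1, h2, h3, h4⟩ := T.exists_parent r
  refine ⟨par, h1, h2, ?_⟩
  rw [prec, ← h4, sum_image h3]
  simp

theorem one_sub_weight_sq_pos {V : Type*} {T : GaussianTree V}
    (hw : ∀ e ∈ T.graph.edgeSet, |T.w e| < 1) {u v : V} (h : T.graph.Adj u v) :
    0 < 1 - T.w s(u, v) ^ 2 := by
  have := hw s(u, v) h
  have := (sq_lt_one_iff_abs_lt_one _).2 this
  linarith

/-- With the tree rooted at `r`, the edge from `v` to its parent sends the column to `-σ_vr e_v`,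
which cancels the entry at `v` contributed by the identity. Only the root entry, equal to 1,
survives. -/
theorem prec_mulVec_cov {V : Type*} [Fintype V] [DecidableEq V] (T : GaussianTree V)
    (hw : ∀ e ∈ T.graph.edgeSet, |T.w e| < 1) (r : V) :
    T.prec *ᵥ (fun v => T.cov v r) = Pi.single r 1 := by
  obtain ⟨par, hadj, hcov, hprec⟩ := T.prec_eq_rooted r
  have hterm : ∀ v ∈ univ.erase r,
      edgeForm (T.w s(v, par v)) v (par v) *ᵥ (fun v => T.cov v r) =
        -Pi.single v (T.cov v r) := by
    intro v hv
    have hv : v ≠ r := (mem_erase.1 hv).1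
    have h := one_sub_weight_sq_pos hw (hadj v hv)
    rw [edgeForm_mulVec, hcov v hv]
    generalize T.w s(v, par v) = w at *
    ext u
    simp only [Pi.smul_apply, Pi.add_apply, Pi.neg_apply, smul_eq_mul, Pi.single_apply]
    split_ifs <;> field_simp <;> ring
  rw [hprec, add_mulVec, one_mulVec, sum_mulVec, sum_congr rfl hterm]
  ext u
  simp only [Pi.add_apply, Finset.sum_apply, Pi.neg_apply, Pi.single_apply, sum_neg_distrib,
    sum_ite_eq, mem_erase, mem_univ, and_true]
  by_cases hu : u = r
  · simp [hu, T.cov_self]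
  · simp [hu]

theorem prec_mul_cov {V : Type*} [Fintype V] [DecidableEq V] (T : GaussianTree V)
    (hw : ∀ e ∈ T.graph.edgeSet, |T.w e| < 1) : T.prec * T.cov = 1 := by
  ext i j
  have := congrFun (T.prec_mulVec_cov hw j) i
  simpa [Matrix.mul_apply, mulVec, dotProduct, Pi.single_apply, Matrix.one_apply] using this

theorem cov_inv {V : Type*} [Fintype V] [DecidableEq V] (T : GaussianTree V)
    (hw : ∀ e ∈ T.graph.edgeSet, |T.w e| < 1) : T.cov⁻¹ = T.prec :=
  Matrix.inv_eq_left_inv (T.prec_mul_cov hw)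

/-- Rooting at `r` and completing squares, the quadratic form is `x_r²` plus the sum of `(x_v - w
x_par)² / (1 - w²)` over the other nodes. As `r` is arbitrary, this gives definiteness. -/
theorem sq_le_prec {V : Type*} [Fintype V] [DecidableEq V] (T : GaussianTree V)
    (hw : ∀ e ∈ T.graph.edgeSet, |T.w e| < 1) (x : V → ℝ) (r : V) :
    x r ^ 2 ≤ x ⬝ᵥ (T.prec *ᵥ x) := by
  obtain ⟨par, hadj, -, hprec⟩ := T.prec_eq_rooted r
  have hterm : ∀ v ∈ univ.erase r,
      - x v ^ 2 ≤ x ⬝ᵥ (edgeForm (T.w s(v, par v)) v (par v) *ᵥ x) := by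
    intro v hv
    have h := one_sub_weight_sq_pos hw (hadj v (mem_erase.1 hv).1)
    rw [edgeForm_mulVec]
    generalize T.w s(v, par v) = w at *
    simp only [dotProduct_smul, dotProduct_add, dotProduct_single, smul_eq_mul]
    have : 0 ≤ (x v - w * x (par v)) ^ 2 / (1 - w ^ 2) := by positivity
    have e : 1 / (1 - w ^ 2) * ((w ^ 2 * x v - w * x (par v)) * (x v * 1) +
        (w ^ 2 * x (par v) - w * x v) * (x (par v) * 1)) =
        (x v - w * x (par v)) ^ 2 / (1 - w ^ 2) - x v ^ 2 := by
      field_simp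
      ring
    rw [e]
    linarith
  rw [hprec, add_mulVec, one_mulVec, sum_mulVec, dotProduct_add, dotProduct_sum]
  have h1 := sum_le_sum hterm
  have h2 : x ⬝ᵥ x = x r ^ 2 + ∑ v ∈ univ.erase r, x v ^ 2 := by
    rw [add_sum_erase _ (fun v => x v ^ 2) (mem_univ r)]
    simp [dotProduct, sq]
  rw [sum_neg_distrib] at h1
  linarith

theorem prec_posDef {V : Type*} [Fintype V] [DecidableEq V] (T : GaussianTree V)
    (hw : ∀ e ∈ T.graph.edgeSet, |T.w e| < 1) : T.prec.PosDef := by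
  refine Matrix.PosDef.of_dotProduct_mulVec_pos ?_ ?_
  · simpa [Matrix.IsHermitian] using T.prec_transpose
  · intro x hx
    obtain ⟨r, hr⟩ := Function.ne_iff.1 hx
    have h := T.sq_le_prec hw x r
    have : 0 < x r ^ 2 := by
      have : x r ≠ 0 := hr
      positivity
    simpa using this.trans_le h

/-- Positive definiteness tested on `e_p - e_q` gives `2 - 2 σ_pq > 0`. -/
theorem cov_lt_one {V : Type*} [Fintype V] [DecidableEq V] (T : GaussianTree V)
    (hw : ∀ e ∈ T.graph.edgeSet, |T.w e| < 1) {p q : V} (hpq : p ≠ q) : T.cov p q < 1 := by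
  have hpd : T.cov.PosDef := by
    rw [← Matrix.inv_eq_right_inv (T.prec_mul_cov hw)]
    exact (T.prec_posDef hw).inv
  have hx : (Pi.single p 1 - Pi.single q 1 : V → ℝ) ≠ 0 := by
    intro h
    have := congrFun h p
    simp [hpq] at this
  have h := hpd.dotProduct_mulVec_pos hx
  simp [mulVec_sub, sub_dotProduct, T.cov_self, T.cov_symm q p] at h
  linarith

end GaussianTree

/-! ### The two sides of an edge of a tree -/

/-- The nodes on the side of `a` once the edge `{a, b}` is cut. -/
def SimpleGraph.edgeSide {V : Type*} (G : SimpleGraph V) (a b : V) : Set V :=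
  {v | (G.deleteEdges {s(a, b)}).Reachable a v}

namespace SimpleGraph

variable {V : Type*} {G : SimpleGraph V} {a b : V}

theorem left_mem_edgeSide : a ∈ G.edgeSide a b := Reachable.refl _

theorem edgeSide_closed {u v : V} (hu : u ∈ G.edgeSide a b) (h : G.Adj u v)
    (hne : s(u, v) ≠ s(a, b)) : v ∈ G.edgeSide a b :=
  Reachable.trans hu (Adj.reachable (by simpa [deleteEdges_adj, h] using hne))

theorem right_notMem_edgeSide (hG : G.IsAcyclic) (h : G.Adj a b) : b ∉ G.edgeSide a b :=
  isBridge_iff.1 (isAcyclic_iff_forall_adj_isBridge.1 hG h)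

theorem edgeSide_disjoint (hG : G.IsAcyclic) (h : G.Adj a b) :
    Disjoint (G.edgeSide a b) (G.edgeSide b a) := by
  rw [Set.disjoint_left]
  intro v hv hv'
  rw [edgeSide, Sym2.eq_swap] at hv'
  exact right_notMem_edgeSide hG h (Reachable.trans hv (Reachable.symm hv'))

/-- A set of nodes containing `u` but not `v` in a connected graph is left by some edge. -/
theorem Connected.exists_boundary_adj (hG : G.Connected) {S : Set V} {u v : V} (hu : u ∈ S)
    (hv : v ∉ S) : ∃ x ∈ S, ∃ y ∉ S, G.Adj x y := by
  obtain ⟨P⟩ := hG.preconnected u v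
  obtain ⟨d, -, h1, h2⟩ := P.exists_boundary_dart S hu hv
  exact ⟨_, h1, _, h2, d.adj⟩

theorem mem_edgeSide_or (hG : G.IsTree) (h : G.Adj a b) (v : V) :
    v ∈ G.edgeSide a b ∨ v ∈ G.edgeSide b a := by
  by_contra hv
  obtain ⟨x, hx, y, hy, hxy⟩ := hG.connected.exists_boundary_adj
    (S := G.edgeSide a b ∪ G.edgeSide b a) (Or.inl left_mem_edgeSide) hv
  have hab : s(x, y) ≠ s(a, b) := by
    intro e
    apply hy
    rcases Sym2.eq_iff.1 e with ⟨-, rfl⟩ | ⟨-, rfl⟩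
    · exact Or.inr left_mem_edgeSide
    · exact Or.inl left_mem_edgeSide
  rcases hx with hx | hx
  · exact hy (Or.inl (edgeSide_closed hx hxy hab))
  · exact hy (Or.inr (edgeSide_closed hx hxy (by rwa [Sym2.eq_swap (a := b)])))

theorem exists_path_of_mem_edgeSide {v : V} (hv : v ∈ G.edgeSide a b) :
    ∃ P : G.Walk a v, P.IsPath ∧ ∀ u ∈ P.support, u ∈ G.edgeSide a b := by
  classical
  obtain ⟨P, hP⟩ := Reachable.exists_isPath hv
  refine ⟨P.mapLe (deleteEdges_le _), hP.mapLe _, fun u hu => ?_⟩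
  rw [Walk.support_mapLe_eq_support] at hu
  exact ⟨P.takeUntil u hu⟩

end SimpleGraph

/-! ### Vectors supported on one side of a cut edge -/

namespace GaussianTree

/-- The covariance of two nodes factors through any edge that separates them. -/
theorem cov_of_separated {V : Type*} (T : GaussianTree V) {i p u v : V} (h : T.graph.Adj i p)
    (hu : u ∈ T.graph.edgeSide i p) (hv : v ∈ T.graph.edgeSide p i) :
    T.cov u v = T.cov u i * T.w s(i, p) * T.cov p v := by
  obtain ⟨P, hP, hPs⟩ := SimpleGraph.exists_path_of_mem_edgeSide hu
  obtain ⟨Q, hQ, hQs⟩ := SimpleGraph.exists_path_of_mem_edgeSide hv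
  have hd := Set.disjoint_left.1 (SimpleGraph.edgeSide_disjoint T.isTree.isAcyclic h)
  have hiQ : (SimpleGraph.Walk.cons h Q).IsPath :=
    (SimpleGraph.Walk.cons_isPath_iff _ _).2
      ⟨hQ, fun hi => hd SimpleGraph.left_mem_edgeSide (hQs _ hi)⟩
  have hR : (P.reverse.append (SimpleGraph.Walk.cons h Q)).IsPath := by
    rw [SimpleGraph.Walk.isPath_def, SimpleGraph.Walk.support_append, List.nodup_append']
    refine ⟨by simpa using hP.support_nodup, ?_, ?_⟩
    · simpa using hQ.support_nodup
    · intro x hx hx'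
      simp only [SimpleGraph.Walk.support_reverse, List.mem_reverse] at hx
      simp only [SimpleGraph.Walk.support_cons, List.tail_cons] at hx'
      exact hd (hPs _ hx) (hQs _ hx')
  rw [T.cov_eq_of_isPath _ hR, T.cov_eq_of_isPath _ hQ, T.cov_eq_of_isPath _ hP.reverse]
  simp [mul_assoc]

theorem cov_of_mem_edgeSide {V : Type*} (T : GaussianTree V) {i p v : V} (h : T.graph.Adj i p)
    (hv : v ∈ T.graph.edgeSide i p) : T.cov v p = T.w s(i, p) * T.cov v i := by
  rw [T.cov_of_separated h hv SimpleGraph.left_mem_edgeSide, T.cov_self]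
  ring

section Cut

variable {V : Type*} [Fintype V] [DecidableEq V] (T : GaussianTree V)

/-- The column of the covariance matrix at `i`, restricted to the `i`-side of the edge `{i, p}`,
and its image under the precision matrix. -/
theorem exists_nearSide_vector (hw : ∀ e ∈ T.graph.edgeSet, |T.w e| < 1) {i p : V}
    (h : T.graph.Adj i p) :
    ∃ x : V → ℝ, (∀ v ∈ T.graph.edgeSide i p, x v = T.cov v i) ∧
      (∀ v ∈ T.graph.edgeSide p i, x v = 0) ∧
      T.prec *ᵥ x = (1 / (1 - T.w s(i, p) ^ 2)) •
        (Pi.single i 1 - T.w s(i, p) • Pi.single p 1) := by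
  have hc := one_sub_weight_sq_pos hw h
  -- Column `i` minus `w` times column `p`: beyond the edge column `i` is `w` times column `p`, so
  -- this vanishes; on the near side it is `1 - w²` times column `i`.
  refine ⟨(1 / (1 - T.w s(i, p) ^ 2)) •
    ((fun v => T.cov v i) - T.w s(i, p) • (fun v => T.cov v p)), ?_, ?_, ?_⟩
  · intro v hv
    simp only [Pi.smul_apply, Pi.sub_apply, smul_eq_mul, T.cov_of_mem_edgeSide h hv]
    field_simp
  · intro v hv
    simp only [Pi.smul_apply, Pi.sub_apply, smul_eq_mul, T.cov_of_mem_edgeSide h.symm hv]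
    rw [Sym2.eq_swap]
    ring
  · rw [mulVec_smul, mulVec_sub, mulVec_smul, T.prec_mulVec_cov hw, T.prec_mulVec_cov hw]

/-- A vector supported on the `p`-side of the edge `{i, p}` that the precision matrix sends to a
multiple of `e_p - e_q`, up to the contribution of the edge. -/
theorem exists_farSide_vector (hw : ∀ e ∈ T.graph.edgeSet, |T.w e| < 1) {i p q : V}
    (h : T.graph.Adj i p) (hpq : p ≠ q) (hq : q ∈ T.graph.edgeSide p i) :
    ∃ x : V → ℝ, (∀ v ∈ T.graph.edgeSide i p, x v = 0) ∧ x p = 1 ∧ x q = -1 ∧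
      ∃ a : ℝ, 0 < a ∧ T.prec *ᵥ x = a • (Pi.single p 1 - Pi.single q 1) -
        (T.w s(i, p) / (1 - T.w s(i, p) ^ 2)) •
          (Pi.single i 1 - T.w s(i, p) • Pi.single p 1) := by
  obtain ⟨y, hy1, hy2, hy3⟩ := T.exists_nearSide_vector hw h
  have ha : 0 < 1 - T.cov p q := sub_pos.2 (T.cov_lt_one hw hpq)
  have ha' : 1 - T.cov q p ≠ 0 := by rw [T.cov_symm]; exact ha.ne'
  -- On the `i`-side, `σ_vp - σ_vq = w σ_vi (1 - σ_pq)`, so the normalized difference of columns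
  -- equals `w • y` there and the subtraction removes it.
  refine ⟨(1 / (1 - T.cov p q)) • ((fun v => T.cov v p) - (fun v => T.cov v q)) -
    T.w s(i, p) • y, ?_, ?_, ?_, 1 / (1 - T.cov p q), by positivity, ?_⟩
  · intro v hv
    simp only [Pi.smul_apply, Pi.sub_apply, smul_eq_mul, T.cov_of_mem_edgeSide h hv, hy1 v hv,
      T.cov_of_separated h hv hq]
    field_simp
    ring
  · simp only [Pi.smul_apply, Pi.sub_apply, smul_eq_mul, hy2 p SimpleGraph.left_mem_edgeSide,
      T.cov_self]
    field_simp
    ring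
  · simp only [Pi.smul_apply, Pi.sub_apply, smul_eq_mul, hy2 q hq, T.cov_self, T.cov_symm p q]
    field_simp
    ring
  · rw [mulVec_sub, mulVec_smul, mulVec_smul, mulVec_sub, T.prec_mulVec_cov hw,
      T.prec_mulVec_cov hw, hy3, smul_smul, mul_one_div]

end Cut

end GaussianTree

/-! ### A graft preserves the determinant -/

/-- The difference of the contributions of the edges `{i, p}` and `{i, q}` of the same weight. -/
theorem edgeForm_sub {V : Type*} [DecidableEq V] (w : ℝ) (i p q : V) :
    edgeForm w i p - edgeForm w i q = (1 / (1 - w ^ 2) / 2) •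
      (vecMulVec (Pi.single p 1 - Pi.single q 1)
          (w ^ 2 • (Pi.single p 1 + Pi.single q 1) - (2 * w) • Pi.single i 1) +
        vecMulVec (w ^ 2 • (Pi.single p 1 + Pi.single q 1) - (2 * w) • Pi.single i 1)
          (Pi.single p 1 - Pi.single q 1)) := by
  ext u v
  simp only [edgeForm, Matrix.sub_apply, Matrix.smul_apply, Matrix.add_apply, vecMulVec_apply,
    Pi.sub_apply, Pi.smul_apply, Pi.add_apply, smul_eq_mul, Matrix.single_apply, Pi.single_apply,
    ite_and, eq_comm (b := u), eq_comm (b := v)]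
  split_ifs <;> ring

/-- A symmetric matrix and its congruent by `1 - x yᵀ` have the same determinant if
`y ⬝ᵥ x = 2`. -/
theorem det_reflection {V : Type*} [Fintype V] [DecidableEq V] (A : Matrix V V ℝ) (x y : V → ℝ)
    (h : y ⬝ᵥ x = 2) : ((1 - vecMulVec y x) * A * (1 - vecMulVec x y)).det = A.det := by
  have h1 : (1 - vecMulVec x y).det = -1 := by
    rw [sub_eq_add_neg, ← neg_vecMulVec, vecMulVec_eq Unit,
      det_one_add_replicateCol_mul_replicateRow]
    simp [h]
    norm_num
  have h2 : (1 - vecMulVec y x).det = -1 := by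
    rw [← h1, ← det_transpose]
    simp [transpose_vecMulVec]
  rw [det_mul, det_mul, h1, h2]
  ring

theorem GaussianTree.det_prec_sub_edgeForm {V : Type*} [Fintype V] [DecidableEq V]
    (T : GaussianTree V) (hw : ∀ e ∈ T.graph.edgeSet, |T.w e| < 1) {i p q : V}
    (h : T.graph.Adj i p) (hpq : p ≠ q) (hq : q ∈ T.graph.edgeSide p i) :
    (T.prec - (edgeForm (T.w s(i, p)) i p - edgeForm (T.w s(i, p)) i q)).det = T.prec.det := by
  obtain ⟨x, hx0, hxp, hxq, a, -, hx⟩ := T.exists_farSide_vector hw h hpq hq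
  have hc := one_sub_weight_sq_pos hw h
  set y : V → ℝ := Pi.single p 1 - Pi.single q 1 with hy
  have hxi : x i = 0 := hx0 i SimpleGraph.left_mem_edgeSide
  -- Expanding the congruence gives `K - y (K x)ᵀ - (K x) yᵀ + (xᵀ K x) y yᵀ`; the terms in `a`
  -- cancel because `xᵀ K x = 2 a + w² / (1 - w²)`.
  rw [← det_reflection T.prec x y (by simp [hy, hxp, hxq]; norm_num)]
  congr 1
  have hx' : x ᵥ* T.prec = T.prec *ᵥ x := by
    rw [← mulVec_transpose, T.prec_transpose]
  have hxx : x ⬝ᵥ (T.prec *ᵥ x) = 2 * a + T.w s(i, p) ^ 2 / (1 - T.w s(i, p) ^ 2) := by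
    rw [hx]
    simp [hy, hxi, hxp, hxq]
    field_simp
    ring
  simp only [sub_mul, mul_sub, one_mul, mul_one, mul_vecMulVec, vecMulVec_mul, hx']
  rw [vecMulVec_mulVec, dotProduct_comm, hxx, hx, edgeForm_sub]
  ext u v
  simp only [Matrix.sub_apply, Matrix.smul_apply, Matrix.add_apply, vecMulVec_apply,
    Pi.sub_apply, Pi.smul_apply, Pi.add_apply, smul_eq_mul, hy, MulOpposite.smul_eq_mul_unop,
    MulOpposite.unop_op]
  field_simp
  ring

/-! ### The Chernoff equation as a trace equation, and its uniqueness -/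

section Chernoff

variable {V : Type*} [Fintype V] [DecidableEq V]

open scoped MatrixOrder Matrix.Norms.L2Operator in
theorem Matrix.PosDef.exists_eq_mul_transpose {Q : Matrix V V ℝ} (hQ : Q.PosDef) :
    ∃ C : Matrix V V ℝ, IsUnit C ∧ Q = C * Cᵀ := by
  obtain ⟨Y, hY⟩ := CStarAlgebra.nonneg_iff_eq_star_mul_self.mp hQ.posSemidef.nonneg
  rw [star_eq_conjTranspose, conjTranspose_eq_transpose_of_trivial] at hY
  refine ⟨Yᵀ, ?_, by rw [transpose_transpose, hY]⟩
  have h := (Matrix.isUnit_iff_isUnit_det _).1 hQ.isUnit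
  rw [hY, det_mul] at h
  exact (Matrix.isUnit_iff_isUnit_det _).2 (isUnit_of_mul_isUnit_left h)

/-- Writing `Q = C Cᵀ` with `C` invertible turns the trace into that of the positive semidefinite
matrix `(D C)ᵀ P (D C)`, which is zero only if `D C = 0`. -/
theorem trace_mul_mul_mul_pos {P Q D : Matrix V V ℝ} (hP : P.PosDef) (hQ : Q.PosDef)
    (hD : Dᵀ = D) (hne : D ≠ 0) : 0 < (D * P * D * Q).trace := by
  obtain ⟨C, hC, rfl⟩ : ∃ C : Matrix V V ℝ, IsUnit C ∧ Q = C * Cᵀ := hQ.exists_eq_mul_transpose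
  have e : (D * P * D * (C * Cᵀ)).trace = ((D * C)ᴴ * P * (D * C)).trace := by
    rw [← Matrix.mul_assoc, trace_mul_comm]
    simp [conjTranspose_eq_transpose_of_trivial, transpose_mul, hD, Matrix.mul_assoc]
  have hps : ((D * C)ᴴ * P * (D * C)).PosSemidef :=
    hP.posSemidef.conjTranspose_mul_mul_same _
  rw [e]
  refine lt_of_le_of_ne hps.trace_nonneg fun h0 => hne ?_
  have hz := hps.trace_eq_zero_iff.1 h0.symm
  have hDC : D * C = 0 := by
    refine Matrix.toLin'.injective (LinearMap.ext fun v => ?_)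
    by_contra hv
    have hp := hP.dotProduct_mulVec_pos (x := (D * C) *ᵥ v) (by simpa using hv)
    rw [star_mulVec, ← dotProduct_mulVec, mulVec_mulVec, mulVec_mulVec, hz] at hp
    simp at hp
  simpa using hC.mul_left_eq_zero.1 hDC

theorem expFamilyPrec_posDef {V : Type*} {A B : Matrix V V ℝ} (hA : A.PosDef) (hB : B.PosDef) {t : ℝ}
    (ht : t ∈ Set.Icc (0 : ℝ) 1) : (t • A + (1 - t) • B).PosDef := by
  rcases ht.1.eq_or_lt with rfl | h0
  · simpa using hB
  · exact (hA.smul h0).add_posSemidef (hB.posSemidef.smul (sub_nonneg.2 ht.2))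

/-- For equal determinants, the equation of the optimal Chernoff parameter only involves traces. -/
theorem isChernoffParameter_iff_trace {S₁ S₂ : Matrix V V ℝ} (hdet : S₁.det = S₂.det) (t : ℝ) :
    IsChernoffParameter S₁ S₂ t ↔ t ∈ Set.Icc (0 : ℝ) 1 ∧
      ((S₁⁻¹ - S₂⁻¹) * (t • S₁⁻¹ + (1 - t) • S₂⁻¹)⁻¹).trace = 0 := by
  unfold IsChernoffParameter gaussianKL expFamilyCov
  rw [hdet, sub_mul, trace_sub]
  refine and_congr_right fun _ => ⟨fun h => ?_, fun h => ?_⟩ <;> linarith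

theorem isChernoffParameter_unique {S₁ S₂ : Matrix V V ℝ} (h1 : S₁⁻¹.PosDef) (h2 : S₂⁻¹.PosDef)
    (hdet : S₁.det = S₂.det) (hne : S₁⁻¹ ≠ S₂⁻¹) {s t : ℝ} (hs : IsChernoffParameter S₁ S₂ s)
    (ht : IsChernoffParameter S₁ S₂ t) : s = t := by
  rw [isChernoffParameter_iff_trace hdet] at hs ht
  obtain ⟨hsI, hs⟩ := hs
  obtain ⟨htI, ht⟩ := ht
  have hPs := expFamilyPrec_posDef h1 h2 hsI
  have hPt := expFamilyPrec_posDef h1 h2 htI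
  set D := S₁⁻¹ - S₂⁻¹ with hD
  set P := s • S₁⁻¹ + (1 - s) • S₂⁻¹ with hP
  set Q := t • S₁⁻¹ + (1 - t) • S₂⁻¹ with hQ
  have hPQ : Q - P = (t - s) • D := by
    rw [hP, hQ, hD]
    module
  have hDt : Dᵀ = D := by
    have e1 := h1.isHermitian
    have e2 := h2.isHermitian
    rw [IsHermitian, conjTranspose_eq_transpose_of_trivial] at e1 e2
    rw [hD, transpose_sub, e1, e2]
  have hpos := trace_mul_mul_mul_pos hPs.inv hPt.inv hDt (sub_ne_zero.2 hne)
  -- The resolvent identity.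
  have hres : P⁻¹ - Q⁻¹ = (t - s) • (P⁻¹ * D * Q⁻¹) := by
    have hPu : IsUnit P.det := (Matrix.isUnit_iff_isUnit_det _).1 hPs.isUnit
    have hQu : IsUnit Q.det := (Matrix.isUnit_iff_isUnit_det _).1 hPt.isUnit
    rw [← Matrix.smul_mul, ← Matrix.mul_smul, ← hPQ, mul_sub, sub_mul,
      Matrix.nonsing_inv_mul _ hPu, Matrix.mul_assoc, Matrix.mul_nonsing_inv _ hQu]
    simp
  have h0 : (D * (P⁻¹ - Q⁻¹)).trace = 0 := by rw [mul_sub, trace_sub, hs, ht, sub_zero]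
  rw [hres, Matrix.mul_smul, trace_smul, ← Matrix.mul_assoc, ← Matrix.mul_assoc, smul_eq_mul,
    mul_eq_zero] at h0
  rcases h0 with h0 | h0
  · linarith
  · exact absurd h0 hpos.ne'

/-- The trace is `2 xᵀ M⁻¹ y`, and `M⁻¹ y` is a multiple of `z`, which is orthogonal to `x`. -/
theorem trace_symm_vecMulVec_mul_inv {M : Matrix V V ℝ} (hM : IsUnit M) (hMt : Mᵀ = M)
    {x y z : V → ℝ} {b : ℝ} (hy : y = b • (M *ᵥ z)) (hxz : x ⬝ᵥ z = 0) :
    ((vecMulVec x y + vecMulVec y x) * M⁻¹).trace = 0 := by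
  have hMd : IsUnit M.det := (Matrix.isUnit_iff_isUnit_det _).1 hM
  have h1 : M⁻¹ *ᵥ y = b • z := by
    rw [hy, mulVec_smul, mulVec_mulVec, Matrix.nonsing_inv_mul _ hMd, one_mulVec]
  have h2 : y ᵥ* M⁻¹ = b • z := by
    rw [← h1, ← mulVec_transpose, transpose_nonsing_inv, hMt]
  rw [add_mul, trace_add, vecMulVec_mul, vecMulVec_mul, trace_vecMulVec, trace_vecMulVec, h2,
    dotProduct_comm y, ← dotProduct_mulVec, h1, dotProduct_smul, hxz]
  simp

end Chernoff

/-! ### The trace contribution of one graft -/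

section SingleGrafting

variable {V : Type*} [Fintype V] [DecidableEq V] (T : GaussianTree V)

/-- A grafting operation contributes nothing to the trace in the equation of the optimal Chernoff
parameter if the remaining operations do not affect one of the two sides of its edge. -/
theorem GaussianTree.trace_grafting_eq_zero (hw : ∀ e ∈ T.graph.edgeSet, |T.w e| < 1) {i p q : V}
    (h : T.graph.Adj i p) (hpq : p ≠ q) (hq : q ∈ T.graph.edgeSide p i) {R M : Matrix V V ℝ}
    (hM : IsUnit M) (hMt : Mᵀ = M)
    (hMR : M = (2 : ℝ) • T.prec -
      ((edgeForm (T.w s(i, p)) i p - edgeForm (T.w s(i, p)) i q) + R))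
    (hR : (∀ x : V → ℝ, (∀ v ∈ T.graph.edgeSide p i, x v = 0) → R *ᵥ x = 0) ∨
      (∀ x : V → ℝ, (∀ v ∈ T.graph.edgeSide i p, x v = 0) → R *ᵥ x = 0)) :
    ((edgeForm (T.w s(i, p)) i p - edgeForm (T.w s(i, p)) i q) * M⁻¹).trace = 0 := by
  have hc := one_sub_weight_sq_pos hw h
  have hip : i ≠ p := h.ne
  have hiq : i ≠ q := by
    rintro rfl
    exact SimpleGraph.right_notMem_edgeSide T.isTree.isAcyclic h.symm hq
  rw [edgeForm_sub, Matrix.smul_mul, trace_smul]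
  rcases hR with hR | hR
  · obtain ⟨x, hx1, hx2, hx3⟩ := T.exists_nearSide_vector hw h
    have hxi : x i = 1 := by rw [hx1 i SimpleGraph.left_mem_edgeSide, T.cov_self]
    have hxp : x p = 0 := hx2 p SimpleGraph.left_mem_edgeSide
    have hxq : x q = 0 := hx2 q hq
    -- Here `M x = (2 e_i - w (e_p + e_q)) / (1 - w²)`, which determines `b`; for `w = 0` both `u`
    -- and `b` vanish.
    rw [trace_symm_vecMulVec_mul_inv hM hMt (z := x)
      (b := -(T.w s(i, p) * (1 - T.w s(i, p) ^ 2)))]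
    · simp
    · rw [hMR, sub_mulVec, smul_mulVec, add_mulVec, hR x hx2, hx3, sub_mulVec, edgeForm_mulVec,
        edgeForm_mulVec, hxi, hxp, hxq]
      generalize T.w s(i, p) = w at *
      ext v
      simp only [Pi.smul_apply, Pi.sub_apply, Pi.add_apply, Pi.zero_apply, smul_eq_mul]
      field_simp
      ring
    · simp [sub_dotProduct, hxp, hxq]
  · obtain ⟨x, hx1, hxp, hxq, a, ha, hx3⟩ := T.exists_farSide_vector hw h hpq hq
    have hxi : x i = 0 := hx1 i SimpleGraph.left_mem_edgeSide
    have hb : 0 < 2 * a + T.w s(i, p) ^ 2 / (1 - T.w s(i, p) ^ 2) := by positivity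
    -- Now `M x = (2 a + w² / (1 - w²)) (e_p - e_q)`, and the vector orthogonal to `x` is `u`, since
    -- `x_p + x_q = 0` and `x_i = 0`.
    rw [add_comm, trace_symm_vecMulVec_mul_inv hM hMt (z := x)
      (b := (2 * a + T.w s(i, p) ^ 2 / (1 - T.w s(i, p) ^ 2))⁻¹)]
    · simp
    · rw [eq_inv_smul_iff₀ hb.ne', hMR, sub_mulVec, smul_mulVec, add_mulVec, hR x hx1, hx3,
        sub_mulVec, edgeForm_mulVec, edgeForm_mulVec, hxi, hxp, hxq]
      generalize T.w s(i, p) = w at *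
      ext v
      simp only [Pi.smul_apply, Pi.sub_apply, Pi.add_apply, Pi.zero_apply, smul_eq_mul]
      field_simp
      ring
    · simp [sub_dotProduct, hxi, hxp, hxq]

end SingleGrafting

/-- If every edge of a connected graph but `{i, q}` respects a side of the edge `{i, p}` of a
tree `G`, then `q` is on the side of `p`. -/
theorem SimpleGraph.mem_edgeSide_of_graft {V : Type*} {G H : SimpleGraph V} {i p q : V}
    (hG : G.IsTree) (hH : H.Connected) (hadj : G.Adj i p) {S : Set V}
    (hS : S = G.edgeSide i p ∨ S = G.edgeSide p i)
    (hedge : ∀ x ∈ S, ∀ y, s(x, y) ∈ H.edgeSet → s(x, y) ≠ s(i, q) →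
      s(x, y) ∈ G.edgeSet ∧ s(x, y) ≠ s(i, p)) :
    q ∈ G.edgeSide p i := by
  have hor := SimpleGraph.mem_edgeSide_or hG hadj
  have hi : i ∈ G.edgeSide i p := SimpleGraph.left_mem_edgeSide
  have hp : p ∈ G.edgeSide p i := SimpleGraph.left_mem_edgeSide
  have hd := Set.disjoint_left.1 (SimpleGraph.edgeSide_disjoint hG.isAcyclic hadj)
  rcases hS with rfl | rfl
  -- Connectedness of `H` forces an edge out of the side `S`. An edge of `G` other than `{i, p}`
  -- cannot leave it, so the edge is `{i, q}`.
  · obtain ⟨x, hx, y, hy, hxy⟩ :=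
      hH.exists_boundary_adj hi (fun h' => hd h' hp)
    by_cases hne : s(x, y) = s(i, q)
    · rcases Sym2.eq_iff.1 hne with ⟨-, rfl⟩ | ⟨-, rfl⟩
      · exact (hor _).resolve_left hy
      · exact absurd hi hy
    · obtain ⟨h1, h2⟩ := hedge x hx y hxy hne
      exact absurd (SimpleGraph.edgeSide_closed hx h1 h2) hy
  · obtain ⟨x, hx, y, hy, hxy⟩ :=
      hH.exists_boundary_adj hp (fun h' => hd hi h')
    by_cases hne : s(x, y) = s(i, q)
    · rcases Sym2.eq_iff.1 hne with ⟨rfl, -⟩ | ⟨rfl, -⟩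
      · exact absurd hx (hd hi)
      · exact hx
    · obtain ⟨h1, h2⟩ := hedge x hx y hxy hne
      exact absurd (SimpleGraph.edgeSide_closed hx h1 (by rwa [Sym2.eq_swap (a := p)])) hy

/-! ### Effect of a graft on weights, edges and precision matrix -/

namespace GraftingOp

/-- The change of the precision matrix under a grafting operation on a tree with edge
weights `w`. -/
noncomputable def precDrop {V : Type*} [DecidableEq V] (o : GraftingOp V) (w : Sym2 V → ℝ) :
    Matrix V V ℝ :=
  edgeForm (w s(o.i, o.p)) o.i o.p - edgeForm (w s(o.i, o.p)) o.i o.q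

theorem precDrop_mulVec_eq_zero {V : Type*} [Fintype V] [DecidableEq V] (o : GraftingOp V)
    (w : Sym2 V → ℝ) {x : V → ℝ} (hi : x o.i = 0) (hp : x o.p = 0) (hq : x o.q = 0) :
    o.precDrop w *ᵥ x = 0 := by
  simp [precDrop, sub_mulVec, edgeForm_mulVec, hi, hp, hq]

namespace Carries

variable {V : Type*} {o : GraftingOp V} {T T' : GaussianTree V}

theorem adj (h : o.Carries T T') : T.graph.Adj o.i o.p := h.2.1

theorem mem_edgeSet (h : o.Carries T T') {e : Sym2 V} (he : e ∈ T'.graph.edgeSet)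
    (hne : e ≠ s(o.i, o.q)) : e ∈ T.graph.edgeSet ∧ e ≠ s(o.i, o.p) ∧ T'.w e = T.w e := by
  have he' := he
  rw [h.2.2.1] at he'
  rcases he' with he' | he'
  · exact ⟨he'.1, he'.2, h.2.2.2.2 e he hne⟩
  · exact absurd he' hne

theorem abs_weight_lt (h : o.Carries T T') (hw : ∀ e ∈ T.graph.edgeSet, |T.w e| < 1) :
    ∀ e ∈ T'.graph.edgeSet, |T'.w e| < 1 := by
  intro e he
  by_cases hne : e = s(o.i, o.q)
  · rw [hne, h.2.2.2.1]
    exact hw _ h.adj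
  · obtain ⟨h1, -, h2⟩ := h.mem_edgeSet he hne
    rw [h2]
    exact hw e h1

theorem mem_edgeSide (h : o.Carries T T') : o.q ∈ T.graph.edgeSide o.p o.i :=
  SimpleGraph.mem_edgeSide_of_graft T.isTree T'.isTree.connected h.adj (Or.inl rfl) fun _ _ _ he hne =>
    ⟨(h.mem_edgeSet he hne).1, (h.mem_edgeSet he hne).2.1⟩

theorem notMem_edgeSet (h : o.Carries T T') : s(o.i, o.q) ∉ T.graph.edgeSet := by
  intro he
  have hne : s(o.i, o.q) ≠ s(o.i, o.p) := by
    intro e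
    exact h.1 (Sym2.congr_right.1 e).symm
  exact Set.disjoint_left.1 (SimpleGraph.edgeSide_disjoint T.isTree.isAcyclic h.adj)
    (SimpleGraph.edgeSide_closed SimpleGraph.left_mem_edgeSide he hne) h.mem_edgeSide

variable [Fintype V] [DecidableEq V]

theorem prec_eq (h : o.Carries T T') : T'.prec = T.prec - o.precDrop T.w := by
  have hedges : T'.edges = insert s(o.i, o.q) (T.edges.erase s(o.i, o.p)) := by
    ext e
    simp only [GaussianTree.mem_edges, h.2.2.1, mem_insert, mem_erase, Set.mem_union, Set.mem_sdiff,
      Set.mem_singleton_iff]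
    tauto
  have hnm : s(o.i, o.q) ∉ T.edges.erase s(o.i, o.p) := by
    exact fun he => h.notMem_edgeSet (GaussianTree.mem_edges.1 (mem_of_mem_erase he))
  have hrest : ∀ e ∈ T.edges.erase s(o.i, o.p), edgeMatrix T'.w e = edgeMatrix T.w e := by
    intro e he
    have hne : e ≠ s(o.i, o.q) := by
      rintro rfl
      exact hnm he
    have hwe : T'.w e = T.w e := by
      refine h.2.2.2.2 e ?_ hne
      rw [← GaussianTree.mem_edges, hedges]
      exact mem_insert_of_mem he
    induction e with
    | _ a b => simp [hwe]
  have hsum := add_sum_erase T.edges (edgeMatrix T.w) (a := s(o.i, o.p))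
    (GaussianTree.mem_edges.2 h.2.1)
  rw [GaussianTree.prec, GaussianTree.prec, hedges, sum_insert hnm, sum_congr rfl hrest, ← hsum]
  simp only [edgeMatrix_mk, precDrop, h.2.2.2.1]
  abel

theorem det_prec_eq (h : o.Carries T T') (hw : ∀ e ∈ T.graph.edgeSet, |T.w e| < 1) :
    T'.prec.det = T.prec.det := by
  rw [h.prec_eq, precDrop, T.det_prec_sub_edgeForm hw h.adj h.1 h.mem_edgeSide]

end Carries

end GraftingOp

/-! ### Star groupings and the super leaves involved -/

/-- In a star grouping, cutting an edge at a node of a super leaf isolates a part of this super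
leaf. -/
theorem IsStarGrouping.edgeSide_subset {V : Type*} {G : SimpleGraph V} {m : ℕ}
    {cell : V → Option (Fin m)} (hs : IsStarGrouping G cell) (hG : G.IsTree) {i p : V}
    (h : G.Adj i p) {l : Fin m} (hp : cell p = some l) :
    (∀ v ∈ G.edgeSide i p, cell v = some l) ∨ (∀ v ∈ G.edgeSide p i, cell v = some l) := by
  obtain ⟨hcenter, -, hleaf⟩ := hs
  obtain ⟨⟨c, hc⟩⟩ := hcenter.nonempty
  have hc : cell c = none := hc
  have key : ∀ S : Set V, c ∉ S →
      (∀ x ∈ S, ∀ y ∉ S, G.Adj x y → s(x, y) = s(i, p)) → ∀ v ∈ S, cell v = some l := by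
    intro S hcS hcross
    -- If `S` met the center, connectedness of the center would give a center edge leaving `S`; this
    -- could only be `{i, p}`, but `p` is not in the center.
    have hnone : ∀ v ∈ S, cell v ≠ none := by
      intro v hv hvn
      obtain ⟨⟨x, hxn⟩, hx, ⟨y, hyn⟩, hy, hxy⟩ := hcenter.exists_boundary_adj
        (S := Subtype.val ⁻¹' S) (u := ⟨v, hvn⟩) (v := ⟨c, hc⟩) hv hcS
      have hxn : cell x = none := hxn
      have hyn : cell y = none := hyn
      rcases Sym2.eq_iff.1 (hcross x hx y hy hxy) with ⟨-, rfl⟩ | ⟨rfl, -⟩ <;> simp_all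
    intro v hv
    by_contra hvl
    -- An edge leaving the part of `S` outside `l` must end in `l`, either within `S` or through
    -- `{i, p}`. It would then join two different super leaves.
    obtain ⟨x, ⟨hx, hxl⟩, y, hy, hxy⟩ := hG.connected.exists_boundary_adj
      (S := {v | v ∈ S ∧ cell v ≠ some l}) (u := v) (v := c) ⟨hv, hvl⟩ (fun h' => hcS h'.1)
    have hyl : cell y = some l := by
      by_cases hyS : y ∈ S
      · by_contra hyl
        exact hy ⟨hyS, hyl⟩
      · rcases Sym2.eq_iff.1 (hcross x hx y hyS hxy) with ⟨-, rfl⟩ | ⟨rfl, -⟩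
        · exact hp
        · exact absurd hp hxl
    obtain ⟨l', hl'⟩ := Option.ne_none_iff_exists'.1 (hnone x hx)
    exact hxl (by rw [hl', hleaf x y l' l hxy hl' hyl])
  have hd := Set.disjoint_left.1 (SimpleGraph.edgeSide_disjoint hG.isAcyclic h)
  rcases SimpleGraph.mem_edgeSide_or hG h c with hcs | hcs
  · refine Or.inr (key _ (hd hcs) fun x hx y hy hxy => ?_)
    by_contra hne
    exact hy (SimpleGraph.edgeSide_closed hx hxy (by rwa [Sym2.eq_swap (a := p)]))
  · refine Or.inl (key _ (fun h' => hd h' hcs) fun x hx y hy hxy => ?_)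
    by_contra hne
    exact hy (SimpleGraph.edgeSide_closed hx hxy hne)

theorem GraftingOp.Involves.exists_mem {V : Type*} {o : GraftingOp V} {m : ℕ}
    {cell : V → Option (Fin m)} {L : Set (Fin m)} (h : o.Involves cell L) :
    ∃ l ∈ L, cell o.p = some l := by
  cases h with
  | within l _ hp _ => exact ⟨l, rfl, hp⟩
  | outside l _ hp _ => exact ⟨l, rfl, hp⟩
  | across l l' _ _ hp _ => exact ⟨l, Or.inl rfl, hp⟩

theorem GraftingOp.Involves.cell_ne {V : Type*} {o : GraftingOp V} {m : ℕ}
    {cell : V → Option (Fin m)} {L : Set (Fin m)} (h : o.Involves cell L) {l : Fin m}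
    (hl : l ∉ L) : cell o.i ≠ some l ∧ cell o.p ≠ some l ∧ cell o.q ≠ some l := by
  cases h with
  | within l₁ hi hp hq =>
    have : l₁ ≠ l := fun e => hl e.symm
    simp [hi, hp, hq, this]
  | outside l₁ hi hp hq =>
    have : l₁ ≠ l := fun e => hl e.symm
    simp [hi, hp, hq, this]
  | across l₁ l₂ _ hi hp hq =>
    have h1 : l₁ ≠ l := fun e => hl (Or.inl e.symm)
    have h2 : l₂ ≠ l := fun e => hl (Or.inr e.symm)
    simp [hi, hp, hq, h1, h2]

/-! ### Chains of independent grafts -/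

section Chain

variable {V : Type*} {n : ℕ} {T : Fin (n + 1) → GaussianTree V} {o : Fin n → GraftingOp V}

theorem abs_weight_lt_of_chain (hT : ∀ k : Fin n, (o k).Carries (T k.castSucc) (T k.succ))
    (hw : ∀ e ∈ (T 0).graph.edgeSet, |(T 0).w e| < 1) (j : Fin (n + 1)) :
    ∀ e ∈ (T j).graph.edgeSet, |(T j).w e| < 1 := by
  induction j using Fin.induction with
  | zero => exact hw
  | succ k ih => exact (hT k).abs_weight_lt ih

/-- An edge that was not pasted before is an edge of the first tree, of the same weight. -/
theorem mem_edgeSet_of_chain (hT : ∀ k : Fin n, (o k).Carries (T k.castSucc) (T k.succ))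
    (j : Fin (n + 1)) : ∀ e ∈ (T j).graph.edgeSet,
      (∀ k : Fin n, k.castSucc < j → e ≠ s((o k).i, (o k).q)) →
      e ∈ (T 0).graph.edgeSet ∧ (T j).w e = (T 0).w e := by
  induction j using Fin.induction with
  | zero => exact fun e he _ => ⟨he, rfl⟩
  | succ k ih =>
    intro e he hne
    obtain ⟨h1, -, h2⟩ := (hT k).mem_edgeSet he (hne k Fin.castSucc_lt_succ)
    obtain ⟨h3, h4⟩ := ih e h1 fun k' hk' => hne k' (hk'.trans Fin.castSucc_lt_succ)
    exact ⟨h3, h2.trans h4⟩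

variable [Fintype V] [DecidableEq V]

theorem det_prec_of_chain (hT : ∀ k : Fin n, (o k).Carries (T k.castSucc) (T k.succ))
    (hw : ∀ e ∈ (T 0).graph.edgeSet, |(T 0).w e| < 1) (j : Fin (n + 1)) :
    (T j).prec.det = (T 0).prec.det := by
  induction j using Fin.induction with
  | zero => rfl
  | succ k ih => rw [(hT k).det_prec_eq (abs_weight_lt_of_chain hT hw _), ih]

theorem prec_of_chain (hT : ∀ k : Fin n, (o k).Carries (T k.castSucc) (T k.succ)) :
    (T (Fin.last n)).prec = (T 0).prec - ∑ k, (o k).precDrop (T k.castSucc).w := by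
  have h : ∀ k, (o k).precDrop (T k.castSucc).w = (T k.castSucc).prec - (T k.succ).prec := by
    intro k
    rw [(hT k).prec_eq]
    abel
  -- The sum telescopes: the total of all precision matrices is split off at its first and at its
  -- last term.
  have h1 := Fin.sum_univ_succ (fun j => (T j).prec)
  have h2 := Fin.sum_univ_castSucc (fun j => (T j).prec)
  rw [h1] at h2
  simp only [h, sum_sub_distrib]
  rw [eq_sub_iff_add_eq, add_sub, sub_eq_iff_eq_add, add_comm, ← h2]

/-- Under independent grafting operations, every operation contributes nothing to the trace in the
equation of the optimal Chernoff parameter. -/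
theorem trace_precDrop_of_chain (hT : ∀ k : Fin n, (o k).Carries (T k.castSucc) (T k.succ))
    (hw : ∀ e ∈ (T 0).graph.edgeSet, |(T 0).w e| < 1) (hind : IndependentGraftings (T 0) o)
    (k : Fin n) :
    ((o k).precDrop (T k.castSucc).w *
      ((T 0).prec + (T (Fin.last n)).prec)⁻¹).trace = 0 := by
  obtain ⟨m, cell, L, hstar, hinv, hdisj⟩ := hind
  obtain ⟨l, hl, hp⟩ := (hinv k).exists_mem
  have hcell : ∀ j ≠ k, cell (o j).i ≠ some l ∧ cell (o j).p ≠ some l ∧ cell (o j).q ≠ some l :=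
    fun j hj => (hinv j).cell_ne (Set.disjoint_right.1 (hdisj j k hj) hl)
  have hpaste : ∀ x y, cell x = some l → ∀ j ≠ k, s(x, y) ≠ s((o j).i, (o j).q) := by
    intro x y hx j hj e
    rcases Sym2.eq_iff.1 e with ⟨rfl, -⟩ | ⟨rfl, -⟩
    · exact (hcell j hj).1 hx
    · exact (hcell j hj).2.2 hx
  have hlt : ∀ j : Fin n, j.castSucc < k.castSucc → j ≠ k := by
    rintro j hj rfl
    exact lt_irrefl _ hj
  -- The cut edge has its end `p` in `l`, where no other graft pastes an edge, so it is an original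
  -- edge with its original weight. Each graft can thus be analyzed on the first tree.
  obtain ⟨hadj, hwk⟩ := mem_edgeSet_of_chain hT k.castSucc s((o k).i, (o k).p) (hT k).adj
    fun j hj => by
      rw [Sym2.eq_swap]
      exact hpaste _ _ hp j (hlt j hj)
  have hadj : (T 0).graph.Adj (o k).i (o k).p := hadj
  have hedge : ∀ x, cell x = some l → ∀ y, s(x, y) ∈ (T k.succ).graph.edgeSet →
      s(x, y) ≠ s((o k).i, (o k).q) →
      s(x, y) ∈ (T 0).graph.edgeSet ∧ s(x, y) ≠ s((o k).i, (o k).p) := by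
    intro x hx y he hne
    obtain ⟨h1, h2, -⟩ := (hT k).mem_edgeSet he hne
    exact ⟨(mem_edgeSet_of_chain hT k.castSucc _ h1
      fun j hj => hpaste x y hx j (hlt j hj)).1, h2⟩
  have hside := hstar.edgeSide_subset (T 0).isTree hadj hp
  have hq : (o k).q ∈ (T 0).graph.edgeSide (o k).p (o k).i := by
    rcases hside with hside | hside
    · exact SimpleGraph.mem_edgeSide_of_graft (T 0).isTree (T k.succ).isTree.connected hadj (Or.inl rfl)
        fun x hx => hedge x (hside x hx)
    · exact SimpleGraph.mem_edgeSide_of_graft (T 0).isTree (T k.succ).isTree.connected hadj (Or.inr rfl)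
        fun x hx => hedge x (hside x hx)
  have hpd := ((T 0).prec_posDef hw).add
    ((T (Fin.last n)).prec_posDef (abs_weight_lt_of_chain hT hw _))
  have hor := SimpleGraph.mem_edgeSide_or (T 0).isTree hadj
  -- The other grafts involve no node of `l`, so their total change kills every vector supported on
  -- `l`.
  have hvan : ∀ x : V → ℝ, (∀ v, cell v ≠ some l → x v = 0) →
      (∑ j ∈ univ.erase k, (o j).precDrop (T j.castSucc).w) *ᵥ x = 0 := by
    intro x hx
    rw [sum_mulVec]
    refine sum_eq_zero fun j hj => ?_
    obtain ⟨h1, h2, h3⟩ := hcell j (mem_erase.1 hj).1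
    exact (o j).precDrop_mulVec_eq_zero _ (hx _ h1) (hx _ h2) (hx _ h3)
  have hprec := prec_of_chain hT
  rw [← add_sum_erase univ _ (mem_univ k)] at hprec
  rw [GraftingOp.precDrop, hwk] at hprec ⊢
  refine (T 0).trace_grafting_eq_zero hw hadj (hT k).1 hq hpd.isUnit ?_
    (R := ∑ j ∈ univ.erase k, (o j).precDrop (T j.castSucc).w) ?_ ?_
  · rw [transpose_add, GaussianTree.prec_transpose, GaussianTree.prec_transpose]
  · rw [hprec, two_smul]
    abel
  · rcases hside with hside | hside
    · exact Or.inl fun x hx => hvan x fun v hv =>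
        hx v ((hor v).resolve_left fun h => hv (hside v h))
    · exact Or.inr fun x hx => hvan x fun v hv =>
        hx v ((hor v).resolve_right fun h => hv (hside v h))

end Chain

/-! ### Conclusion -/

theorem mainTheorem4 {V : Type*} [Fintype V] [DecidableEq V] (T₁ T₂ : GaussianTree V)
    (hw : ∀ e ∈ T₁.graph.edgeSet, |T₁.w e| < 1)
    (h : ConnectedByIndependentGraftings T₁ T₂) :
    IsChernoffParameter T₁.cov T₂.cov (1 / 2) ∧
      (T₁.cov ≠ T₂.cov → ∀ t : ℝ, IsChernoffParameter T₁.cov T₂.cov t → t = 1 / 2) := by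
  obtain ⟨n, T, o, rfl, rfl, hT, hind⟩ := h
  have hw' := abs_weight_lt_of_chain hT hw (Fin.last n)
  have hpd := (T 0).prec_posDef hw
  have hpd' := (T (Fin.last n)).prec_posDef hw'
  have hdet : (T 0).cov.det = (T (Fin.last n)).cov.det := by
    have h1 := congrArg det ((T 0).prec_mul_cov hw)
    have h2 := congrArg det ((T (Fin.last n)).prec_mul_cov hw')
    rw [det_mul] at h1 h2
    rw [det_prec_of_chain hT hw, ← h1] at h2
    exact (mul_left_cancel₀ hpd.det_pos.ne' h2).symm
  have hhalf : IsChernoffParameter (T 0).cov (T (Fin.last n)).cov (1 / 2) := by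
    rw [isChernoffParameter_iff_trace hdet, (T 0).cov_inv hw, (T (Fin.last n)).cov_inv hw']
    refine ⟨by norm_num, ?_⟩
    have hM : (1 / 2 : ℝ) • (T 0).prec + (1 - 1 / 2 : ℝ) • (T (Fin.last n)).prec =
        (1 / 2 : ℝ) • ((T 0).prec + (T (Fin.last n)).prec) := by
      module
    have hu : IsUnit ((T 0).prec + (T (Fin.last n)).prec).det :=
      (Matrix.isUnit_iff_isUnit_det _).1 (hpd.add hpd').isUnit
    have hinv : ((1 / 2 : ℝ) • ((T 0).prec + (T (Fin.last n)).prec))⁻¹ =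
        (2 : ℝ) • ((T 0).prec + (T (Fin.last n)).prec)⁻¹ := by
      refine Matrix.inv_eq_left_inv ?_
      rw [Matrix.smul_mul, Matrix.mul_smul, Matrix.nonsing_inv_mul _ hu, smul_smul]
      norm_num
    have hdiff : (T 0).prec - (T (Fin.last n)).prec =
        ∑ k, (o k).precDrop (T k.castSucc).w := by
      rw [prec_of_chain hT]
      abel
    rw [hM, hinv, Matrix.mul_smul, trace_smul, hdiff, Finset.sum_mul, trace_sum,
      sum_eq_zero fun k _ => trace_precDrop_of_chain hT hw hind k, smul_zero]
  refine ⟨hhalf, fun hne t ht => ?_⟩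
  have h1 := (T 0).cov_inv hw
  have h2 := (T (Fin.last n)).cov_inv hw'
  refine isChernoffParameter_unique (h1 ▸ hpd) (h2 ▸ hpd') hdet (fun he => hne ?_) ht hhalf
  rw [h1, h2] at he
  rw [← Matrix.inv_eq_right_inv ((T 0).prec_mul_cov hw), he,
    Matrix.inv_eq_right_inv ((T (Fin.last n)).prec_mul_cov hw')]
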